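/- Let $\mathbb F_q$ be the finite field with $q$ elements and let $\mathbb F_q((X^{-1}))$ be the field of formal Laurent series $f=a_dX^d+a_{d-1}X^{d-1}+\cdots$ ($d\in\mathbb Z$, $a_i\in\mathbb F_q$), with the norm $|f|=q^{d}$ if $a_d\neq 0$ and $|0|=0$, and with the fractional part $\{f\}=a_{-1}X^{-1}+a_{-2}X^{-2}+\cdots$. Let $\mathbb L=\{f\in\mathbb F_q((X^{-1})) : |f|<1\}$, a compact topological group under addition, equipped with its Haar probability measure. Let $(l_n)_{n\ge 0}$ be a non-decreasing sequence of non-negative integers, and let $f\in\mathbb L$ be irrational (not a quotient of two polynomials in $\mathbb F_q[X]$), with principal convergents $P_k/Q_k$, $k\ge 0$, of its continued fraction expansion; put $n_k=\deg Q_k$ (so $Q_0=1$ and $n_0=0$). Then, for almost every $g\in\mathbb L$, the following equivalence holds: \[ |\{Qf\}-g|<\frac1{q^{l_n}},\quad \deg Q=n,\qquad\text{for infinitely many } Q\in\mathbb F_q[X] \] if and only if \[ \sum_{k=0}^{\infty}\ \sum_{n=n_k}^{n_{k+1}-1} q^{\,n-\max\{n_{k+1},\,l_n\}}=\infty . \]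 That is, if the series diverges, then almost every $g$ admits infinitely many such $Q$; if it converges, then almost every $g$ admits only finitely many. -/

import Mathlib

open MeasureTheory

noncomputable section

namespace FormalLaurent

/-- The field `F((X⁻¹))` of formal Laurent series in `X⁻¹`.  It is Mathlib's field of Laurent
series, whose variable is read as `X⁻¹`: the coefficient with index `m` is that of `X ^ (-m)`. -/
abbrev Series (F : Type*) [Field F] : Type _ := LaurentSeries F

section Basic

variable {F : Type*} [Field F]

/-- The inclusion `F[X] → F((X⁻¹))`; the polynomial variable `X` is the series with the single
coefficient `1` at index `-1`. -/
def ofPoly : Polynomial F →+* Series F :=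
  Polynomial.eval₂RingHom HahnSeries.C (HahnSeries.single (-1 : ℤ) (1 : F))

/-- The generalized degree of a series `≠ 0`: the largest `n` such that `X ^ n` has a nonzero
coefficient. (The value at `0` is not used.) -/
def deg (f : Series F) : ℤ := -f.order

open Classical in
/-- The norm `|f| = q ^ deg f`, `|0| = 0`, where `q` is the cardinality of `F`. -/
def absVal (f : Series F) : ℝ := if f = 0 then 0 else (Nat.card F : ℝ) ^ deg f

/-- The fractional part `{f} = a₋₁ X⁻¹ + a₋₂ X⁻² + ⋯` of `f = ∑ aₙ Xⁿ`. -/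
def fract (f : Series F) : Series F where
  coeff m := if 0 < m then f.coeff m else 0
  isPWO_support' := f.isPWO_support.mono fun m hm => by
    simp only [Function.mem_support, ne_eq, ite_eq_right_iff, not_forall] at hm
    exact hm.2

/-- The polynomial part `a₀ + a₁ X + ⋯ + a_d X ^ d` (`d = deg f`) of `f = ∑ aₙ Xⁿ`. -/
def polyPart (f : Series F) : Polynomial F :=
  ∑ i ∈ Finset.range ((deg f).toNat + 1), Polynomial.monomial i (f.coeff (-(i : ℤ)))

/-- `f` is irrational if it is not a quotient of two polynomials. -/
def IsIrrational (f : Series F) : Prop :=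
  ∀ P Q : Polynomial F, Q ≠ 0 → f ≠ ofPoly P / ofPoly Q

/-- The complete quotients of the continued fraction algorithm: `f₀ = f`, `fₖ₊₁ = 1 / {fₖ}`. -/
def completeQuot (f : Series F) : ℕ → Series F
  | 0 => f
  | k + 1 => (fract (completeQuot f k))⁻¹

/-- The partial quotients `Aₖ` of the continued fraction expansion `f = [A₀; A₁, A₂, …]`. -/
def partialQuot (f : Series F) (k : ℕ) : Polynomial F := polyPart (completeQuot f k)

/-- The numerators `Pₖ` of the principal convergents `Pₖ / Qₖ = [A₀; A₁, …, Aₖ]` of `f`. -/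
def convNum (f : Series F) : ℕ → Polynomial F
  | 0 => partialQuot f 0
  | 1 => partialQuot f 1 * partialQuot f 0 + 1
  | k + 2 => partialQuot f (k + 2) * convNum f (k + 1) + convNum f k

/-- The denominators `Qₖ` of the principal convergents `Pₖ / Qₖ = [A₀; A₁, …, Aₖ]` of `f`. -/
def convDen (f : Series F) : ℕ → Polynomial F
  | 0 => 1
  | 1 => partialQuot f 1
  | k + 2 => partialQuot f (k + 2) * convDen f (k + 1) + convDen f k

/-- `nₖ = deg Qₖ`. -/
def convDeg (f : Series F) (k : ℕ) : ℕ := (convDen f k).natDegree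

theorem absVal_nonneg (f : Series F) : 0 ≤ absVal f := by
  unfold absVal
  split_ifs
  · exact le_rfl
  · positivity

@[simp] theorem absVal_zero : absVal (0 : Series F) = 0 := by simp [absVal]

theorem absVal_neg (f : Series F) : absVal (-f) = absVal f := by
  by_cases hf : f = 0
  · rw [hf, neg_zero]
  · rw [absVal, absVal, if_neg hf, if_neg (neg_ne_zero.mpr hf), deg, deg, HahnSeries.order_neg]

end Basic

section UnitBall

variable {F : Type*} [Field F] [Finite F]

theorem one_lt_q (F : Type*) [Field F] [Finite F] : (1 : ℝ) < Nat.card F := by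
  exact_mod_cast Finite.one_lt_card

theorem absVal_le_zpow_iff {f : Series F} {m : ℤ} :
    absVal f ≤ (Nat.card F : ℝ) ^ (-m) ↔ ∀ n < m, f.coeff n = 0 := by
  have hq := one_lt_q F
  have hq0 : (0 : ℝ) < Nat.card F := by linarith
  by_cases hf : f = 0
  · simp [absVal, hf, (zpow_pos hq0 _).le]
  · rw [absVal, if_neg hf, zpow_le_zpow_iff_right₀ hq, deg, neg_le_neg_iff,
      HahnSeries.le_order_iff_forall hf]

theorem absVal_lt_one_iff {f : Series F} : absVal f < 1 ↔ ∀ n < 1, f.coeff n = 0 := by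
  have hq := one_lt_q F
  have hq0 : (0 : ℝ) < Nat.card F := by linarith
  by_cases hf : f = 0
  · simp [absVal, hf]
  · rw [absVal, if_neg hf, ← zpow_zero (Nat.card F : ℝ), zpow_lt_zpow_iff_right₀ hq, deg,
      ← HahnSeries.le_order_iff_forall hf]
    omega

theorem eq_zero_of_absVal_eq_zero {f : Series F} (h : absVal f = 0) : f = 0 := by
  have hq := one_lt_q F
  by_contra hf
  rw [absVal, if_neg hf] at h
  exact (zpow_pos (by linarith : (0 : ℝ) < Nat.card F) _).ne' h

theorem absVal_add_le_max (f g : Series F) : absVal (f + g) ≤ max (absVal f) (absVal g) := by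
  have key : ∀ f g : Series F, absVal f ≤ absVal g → absVal (f + g) ≤ absVal g := by
    intro f g h
    by_cases hg : g = 0
    · subst hg
      rw [absVal_zero] at h
      rw [add_zero, absVal_zero]
      exact h
    · have e : absVal g = (Nat.card F : ℝ) ^ (-g.order) := by rw [absVal, if_neg hg, deg]
      have h2 : absVal g ≤ (Nat.card F : ℝ) ^ (-g.order) := e.le
      rw [e] at h ⊢
      rw [absVal_le_zpow_iff] at h h2 ⊢
      intro n hn
      simp [h n hn, h2 n hn]
  rcases le_total (absVal f) (absVal g) with h | h
  · exact (key f g h).trans (le_max_right _ _)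
  · rw [add_comm]
    exact (key g f h).trans (le_max_left _ _)

theorem absVal_add_le (f g : Series F) : absVal (f + g) ≤ absVal f + absVal g :=
  (absVal_add_le_max f g).trans
    (max_le (by linarith [absVal_nonneg g]) (by linarith [absVal_nonneg f]))

variable (F) in
/-- The additive group of all series `f` with `|f| < 1`. -/
def ballSubgroup : AddSubgroup (Series F) where
  carrier := {f | absVal f < 1}
  zero_mem' := by simp
  add_mem' {f g} hf hg := (absVal_add_le_max f g).trans_lt (max_lt hf hg)
  neg_mem' {f} hf := by
    rw [Set.mem_ofPred_eq, absVal_neg]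
    exact hf

variable (F) in
/-- The set `𝕃 = {f : |f| < 1}`, as a type of its own, so that its topology is the one that comes
from the norm. -/
def UnitBall : Type _ := ballSubgroup F

instance : AddCommGroup (UnitBall F) := inferInstanceAs (AddCommGroup (ballSubgroup F))

/-- The underlying series of an element of `𝕃`. -/
def UnitBall.val (f : UnitBall F) : Series F := Subtype.val (p := (· ∈ ballSubgroup F)) f

instance : Coe (UnitBall F) (Series F) := ⟨UnitBall.val⟩

/-- `𝕃` carries the restriction of the norm, and the metric and topology induced by it. -/
instance : NormedAddCommGroup (UnitBall F) :=
  AddGroupNorm.toNormedAddCommGroup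
    { toFun := fun f => absVal f.val
      map_zero' := absVal_zero
      add_le' := fun f g => absVal_add_le f.val g.val
      neg' := fun f => absVal_neg f.val
      eq_zero_of_map_eq_zero' := fun _ h => Subtype.ext (eq_zero_of_absVal_eq_zero h) }

theorem dist_eq (f g : UnitBall F) : dist f g = absVal (f.val - g.val) := dist_eq_norm_sub f g

/-- The element `∑ᵢ aᵢ X ^ (-i-1)` of `𝕃` with a given sequence of coefficients. -/
def UnitBall.mk (a : ℕ → F) : UnitBall F :=
  ⟨HahnSeries.ofSuppBddBelow (fun m : ℤ => if 0 < m then a (m - 1).toNat else 0)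
    ⟨0, fun m hm => by
      simp only [Function.mem_support, ne_eq, ite_eq_right_iff, not_forall] at hm
      exact hm.1.le⟩, absVal_lt_one_iff.mpr fun n hn => if_neg (by omega)⟩

theorem UnitBall.mk_coeff (a : ℕ → F) (m : ℤ) :
    (UnitBall.mk a).val.coeff m = if 0 < m then a (m - 1).toNat else 0 := rfl

instance : CompactSpace (UnitBall F) := by
  let _ : TopologicalSpace F := ⊥
  have _ : DiscreteTopology F := ⟨rfl⟩
  have hq := one_lt_q F
  have hq0 : (0 : ℝ) < Nat.card F := by linarith
  have hc : Continuous (UnitBall.mk : (ℕ → F) → UnitBall F) := by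
    rw [continuous_iff_continuousAt]
    intro a
    rw [ContinuousAt, Metric.tendsto_nhds]
    intro ε hε
    obtain ⟨N, hN⟩ := exists_pow_lt_of_lt_one hε (inv_lt_one_of_one_lt₀ hq)
    have hev : ∀ᶠ b in nhds a, ∀ i ∈ Finset.range N, b i = a i := by
      rw [Filter.eventually_all_finset]
      intro i _
      have h1 : Filter.Tendsto (fun b : ℕ → F => b i) (nhds a) (nhds (a i)) :=
        (continuous_apply i).continuousAt
      exact h1 (by simp : {a i} ∈ nhds (a i))
    filter_upwards [hev] with b hb
    refine lt_of_le_of_lt ?_ hN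
    rw [dist_eq, inv_pow, ← zpow_natCast, ← zpow_neg, absVal_le_zpow_iff]
    intro n hn
    rw [HahnSeries.coeff_sub, UnitBall.mk_coeff, UnitBall.mk_coeff]
    split_ifs with h
    · rw [hb _ (by rw [Finset.mem_range]; omega), sub_self]
    · simp
  have hs : Function.Surjective (UnitBall.mk : (ℕ → F) → UnitBall F) := by
    intro f
    refine ⟨fun i => f.val.coeff (i + 1), Subtype.ext (HahnSeries.ext (funext fun m => ?_))⟩
    change (UnitBall.mk _).val.coeff m = f.val.coeff m
    rw [UnitBall.mk_coeff]
    split_ifs with h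
    · congr 1
      omega
    · exact ((absVal_lt_one_iff.mp f.2) m (by omega)).symm
  exact hs.compactSpace hc

instance : MeasurableSpace (UnitBall F) := borel _

instance : BorelSpace (UnitBall F) := ⟨rfl⟩

variable (F) in
/-- The Haar probability measure on the compact group `𝕃`. -/
def haar : Measure (UnitBall F) := Measure.addHaarMeasure ⊤

instance : IsProbabilityMeasure (haar F) :=
  ⟨Measure.addHaarMeasure_self (K₀ := (⊤ : TopologicalSpace.PositiveCompacts (UnitBall F)))⟩

instance : (haar F).IsAddLeftInvariant :=
  inferInstanceAs (Measure.addHaarMeasure ⊤ : Measure (UnitBall F)).IsAddLeftInvariant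

end UnitBall

end FormalLaurent

end

/-!
Let `nₖ ≤ n < nₖ₊₁`. The points `{R f}`, `deg R < nₖ`, are `q ^ (-nₖ)`-separated and meet every
ball of radius `q ^ (-nₖ)`, since `Qₖ f` is at distance `q ^ (-nₖ₊₁)` from `F[X]`; and
`Q ↦ Q + R` permutes the polynomials of degree `n`.

Divergence: shrinking the radii, suppose `nₖ₊₁ ≤ l n`, and let `A n` be the union of the disjoint
balls of radius `q ^ (-l n)` around `{Q f}`, `deg Q = n`. Its measure is comparable to
`q ^ (n - l n)`. For `m < n`, if `nₖ₊₁ ≤ l m`, then `A m` and `A n` are disjoint by separation; if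
`l m ≤ nₖ`, they are independent, because `A n` is invariant under the translations by `{R f}`,
`deg R < nₖ`, which permute transitively the balls of radius `q ^ (-l m)`. The remaining `n` lie in
the single block that contains `l m`, where the `A n` are disjoint from each other, so the
covariances of `A m` with all later sets add up to at most the measure of `A m`, and the
second-moment form of the Borel–Cantelli lemma applies.

Convergence: if `n + l n < nₖ + nₖ₊₁`, then every `{Q f}`, `deg Q = n`, agrees at scale `q ^ (-l n)`
with some `{R f}`, `deg R < nₖ`, and `A n` is already covered by the balls belonging to `nₖ - 1`.
Otherwise `A n` is covered by balls of total measure `q ^ (n + 1 - max nₖ₊₁ (l n))`, which are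
larger balls around the points `{R f}`, `deg R < nₖ`, when `l n < nₖ₊₁`.
-/

open Polynomial Filter ProbabilityTheory

section BlockIndex

/-- For an increasing sequence `u` with `u 0 = 0`, the index `k` of the block
`[u k, u (k + 1))` that contains `n`. -/
def blockIndex (u : ℕ → ℕ) (n : ℕ) : ℕ := Nat.findGreatest (fun k => u k ≤ n) n

variable {u : ℕ → ℕ}

theorem apply_blockIndex_le (h0 : u 0 = 0) (n : ℕ) : u (blockIndex u n) ≤ n :=
  Nat.findGreatest_spec (P := fun k => u k ≤ n) n.zero_le (h0.trans_le n.zero_le)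

theorem lt_apply_blockIndex_add_one (hu : StrictMono u) (n : ℕ) :
    n < u (blockIndex u n + 1) := by
  by_contra! h
  exact Nat.findGreatest_is_greatest (Nat.lt_succ_self _) ((hu.le_apply).trans h) h

theorem blockIndex_eq (hu : StrictMono u) {k n : ℕ} (hk : u k ≤ n) (hn : n < u (k + 1)) :
    blockIndex u n = k := by
  refine le_antisymm ?_ (Nat.le_findGreatest (hu.le_apply.trans hk) hk)
  by_contra! h
  exact (Nat.findGreatest_spec (P := fun k => u k ≤ n) (hu.le_apply.trans hk) hk).not_gt
    (hn.trans_le (hu.monotone h))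

theorem tsum_sum_Ico_eq_tsum_blockIndex (hu : StrictMono u) (h0 : u 0 = 0)
    (t : ℕ → ℕ → ENNReal) :
    ∑' k, ∑ n ∈ Finset.Ico (u k) (u (k + 1)), t k n = ∑' n, t (blockIndex u n) n := by
  rw [ENNReal.tsum_eq_iSup_nat, ENNReal.tsum_eq_iSup_nat' hu.tendsto_atTop]
  congr 1
  funext K
  induction K with
  | zero => simp [h0]
  | succ K ih =>
    rw [Finset.sum_range_succ, ih, ← Finset.sum_range_add_sum_Ico _ (hu K.lt_succ_self).le]
    congr 1
    refine Finset.sum_congr rfl fun n hn => ?_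
    rw [Finset.mem_Ico] at hn
    rw [blockIndex_eq hu hn.1 hn.2]

end BlockIndex

section BorelCantelli

theorem sum_range_sum_range_eq_sum_diag_add {R : Type*} [NonAssocSemiring R] {a : ℕ → ℕ → R}
    (ha : ∀ i j, a i j = a j i) (N : ℕ) :
    ∑ i ∈ Finset.range N, ∑ j ∈ Finset.range N, a i j =
      ∑ i ∈ Finset.range N, a i i + 2 * ∑ i ∈ Finset.range N, ∑ j ∈ Finset.Ioo i N, a i j := by
  induction N with
  | zero => simp
  | succ N ih =>
    have hIoo : ∀ i ∈ Finset.range N,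
        ∑ j ∈ Finset.Ioo i (N + 1), a i j = ∑ j ∈ Finset.Ioo i N, a i j + a i N := by
      intro i hi
      rw [Finset.mem_range] at hi
      rw [show Finset.Ioo i (N + 1) = insert N (Finset.Ioo i N) by ext; simp; omega,
        Finset.sum_insert (by simp), add_comm]
    have hlast : Finset.Ioo N (N + 1) = ∅ := by ext; simp
    simp only [Finset.sum_range_succ, Finset.sum_add_distrib, ih, Finset.sum_congr rfl hIoo, hlast,
      Finset.sum_empty, add_zero, ha N, mul_add, two_mul]
    abel

variable {Ω : Type*} [MeasurableSpace Ω] {μ : Measure Ω}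

theorem memLp_indicator_one [IsFiniteMeasure μ] {A : Set Ω} (hA : MeasurableSet A) (p : ENNReal) :
    MemLp (A.indicator (1 : Ω → ℝ)) p μ :=
  memLp_indicator_const p hA 1 (Or.inr (measure_ne_top μ A))

theorem tendsto_sum_measureReal_atTop [IsFiniteMeasure μ] {A : ℕ → Set Ω}
    (hdiv : ∑' n, μ (A n) = ⊤) :
    Tendsto (fun N => ∑ n ∈ Finset.range N, μ.real (A n)) atTop atTop := by
  rw [← not_summable_iff_tendsto_nat_atTop_of_nonneg fun _ => measureReal_nonneg]
  intro hsum
  simpa [hdiv] using hsum.tsum_ofReal_ne_top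

variable [IsProbabilityMeasure μ]

theorem covariance_indicator_one {A B : Set Ω} (hA : MeasurableSet A) (hB : MeasurableSet B) :
    cov[A.indicator (1 : Ω → ℝ), B.indicator 1; μ] = μ.real (A ∩ B) - μ.real A * μ.real B := by
  rw [covariance_eq_sub (memLp_indicator_one hA 2) (memLp_indicator_one hB 2),
    ← Set.inter_indicator_one, integral_indicator_one (hA.inter hB), integral_indicator_one hA,
    integral_indicator_one hB]

theorem ae_infinite_of_variance_sum_indicator_le {ι : Type*} {A : ι → Set Ω}
    (hA : ∀ i, MeasurableSet (A i)) (s : ℕ → Finset ι) {C : ℝ}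
    (hvar : ∀ N, Var[fun x => ∑ i ∈ s N, (A i).indicator (1 : Ω → ℝ) x; μ] ≤
      C * ∑ i ∈ s N, μ.real (A i))
    (hdiv : Tendsto (fun N => ∑ i ∈ s N, μ.real (A i)) atTop atTop) :
    ∀ᵐ x ∂μ, {i | x ∈ A i}.Infinite := by
  set S : ℕ → Ω → ℝ := fun N x => ∑ i ∈ s N, (A i).indicator 1 x
  set E : ℕ → ℝ := fun N => ∑ i ∈ s N, μ.real (A i)
  have hmean : ∀ N, μ[S N] = E N := fun N => by
    rw [integral_finsetSum _ fun i _ => (memLp_indicator_one (hA i) 1).integrable le_rfl]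
    exact Finset.sum_congr rfl fun i _ => integral_indicator_one (hA i)
  have hbounded : ∀ M : ℕ, μ {x | ∀ N, S N x ≤ M} = 0 := by
    intro M
    have hlim : Tendsto (fun N => ENNReal.ofReal (4 * C / E N)) atTop (nhds 0) := by
      simpa using ENNReal.tendsto_ofReal (hdiv.const_div_atTop (4 * C))
    refine le_antisymm (ge_of_tendsto hlim ?_) zero_le
    filter_upwards [hdiv.eventually_ge_atTop (2 * M + 1)] with N hN
    calc μ {x | ∀ N, S N x ≤ M} ≤ μ {x | E N / 2 ≤ |S N x - μ[S N]|} := by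
          refine measure_mono fun x hx => ?_
          rw [Set.mem_ofPred_eq, hmean, abs_sub_comm]
          exact le_trans (by linarith [hx N]) (le_abs_self _)
      _ ≤ ENNReal.ofReal (Var[S N; μ] / (E N / 2) ^ 2) :=
          meas_ge_le_variance_div_sq
            (memLp_finsetSum _ fun i _ => memLp_indicator_one (hA i) 2)
            (by linarith [M.cast_nonneg (α := ℝ)])
      _ ≤ ENNReal.ofReal (4 * C / E N) := by
          refine ENNReal.ofReal_le_ofReal ?_
          have hE : 0 < E N := by linarith [M.cast_nonneg (α := ℝ)]
          rw [div_le_iff₀ (by positivity)]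
          exact (hvar N).trans_eq (by field_simp; ring)
  filter_upwards [ae_all_iff.mpr fun M => measure_eq_zero_iff_ae_notMem.mp (hbounded M)]
    with x hx hfin
  classical
  refine hx hfin.toFinset.card fun N => ?_
  simp only [S, Set.indicator_apply, Pi.one_apply, Finset.sum_boole]
  exact_mod_cast Finset.card_le_card fun i hi => by simpa using (Finset.mem_filter.mp hi).2

theorem ae_infinite_of_sum_Ioo_covariance_le {A : ℕ → Set Ω} (hA : ∀ n, MeasurableSet (A n))
    {C : ℝ}
    (hcov : ∀ m N, ∑ n ∈ Finset.Ioo m N, (μ.real (A m ∩ A n) - μ.real (A m) * μ.real (A n)) ≤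
      C * μ.real (A m))
    (hdiv : ∑' n, μ (A n) = ⊤) : ∀ᵐ x ∂μ, {n | x ∈ A n}.Infinite := by
  refine ae_infinite_of_variance_sum_indicator_le hA Finset.range (C := 1 + 2 * C)
    (fun N => ?_) (tendsto_sum_measureReal_atTop hdiv)
  have hdiag : ∀ n, μ.real (A n ∩ A n) - μ.real (A n) * μ.real (A n) ≤ μ.real (A n) := fun n => by
    rw [Set.inter_self]
    exact sub_le_self _ (mul_self_nonneg _)
  rw [variance_fun_sum' fun n _ => memLp_indicator_one (hA n) 2]
  simp only [covariance_indicator_one (hA _) (hA _)]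
  rw [sum_range_sum_range_eq_sum_diag_add fun m n => by rw [Set.inter_comm, mul_comm],
    add_mul, one_mul, mul_assoc, Finset.mul_sum _ _ C]
  gcongr
  exacts [hdiag _, hcov _ N]

end BorelCantelli

section TranslationInvariance

variable {G A : Type*} [AddGroup G] [MeasurableSpace G] [MeasurableAdd G] {μ : Measure G}
  [μ.IsAddLeftInvariant] [AddGroup A] {φ : G →+ A} {E : Set G}

theorem measure_inter_fiber_eq (hE : ∀ a, ∃ t, φ t = a ∧ (t + ·) ⁻¹' E = E) (a b : A) :
    μ (E ∩ φ ⁻¹' {a}) = μ (E ∩ φ ⁻¹' {b}) := by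
  obtain ⟨t, ht, htE⟩ := hE (a - b)
  have hfib : (t + ·) ⁻¹' (φ ⁻¹' {a}) = φ ⁻¹' {b} := by
    ext x
    simp only [Set.mem_preimage, Set.mem_singleton_iff, map_add, ht, sub_eq_add_neg, add_assoc]
    rw [add_eq_left, neg_add_eq_zero, eq_comm]
  rw [← measure_preimage_add μ t, Set.preimage_inter, htE, hfib]

theorem measure_inter_preimage_of_invariant [Finite A] (hφ : ∀ a, MeasurableSet (φ ⁻¹' {a}))
    (hE : ∀ a, ∃ t, φ t = a ∧ (t + ·) ⁻¹' E = E) (S : Set A) :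
    μ (E ∩ φ ⁻¹' S) = μ E * (S.ncard / Nat.card A) := by
  have hcount : ∀ S : Set A, μ (E ∩ φ ⁻¹' S) = S.ncard * μ (E ∩ φ ⁻¹' {0}) := by
    intro S
    have hsum := sum_measure_preimage_singleton (μ := μ.restrict E) S.toFinite.toFinset
      (f := φ) fun a _ => hφ a
    simp only [Measure.restrict_apply (hφ _), Set.inter_comm _ E, measure_inter_fiber_eq hE _ 0,
      Finset.sum_const, nsmul_eq_mul, Set.Finite.coe_toFinset] at hsum
    rw [Set.ncard_eq_toFinset_card S S.toFinite, hsum, Measure.restrict_apply, Set.inter_comm]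
    rw [← Set.biUnion_preimage_singleton]
    exact S.toFinite.measurableSet_biUnion fun a _ => hφ a
  have hcard : (Nat.card A : ENNReal) ≠ 0 := by exact_mod_cast Nat.card_pos.ne'
  have hE' := hcount Set.univ
  rw [Set.preimage_univ, Set.inter_univ, Set.ncard_univ] at hE'
  rw [hcount, hE', mul_comm (Nat.card A : ENNReal), mul_assoc,
    ENNReal.mul_div_cancel hcard (ENNReal.natCast_ne_top _), mul_comm]

end TranslationInvariance

noncomputable section

namespace FormalLaurent

section Series

variable {F : Type*} [Field F]

theorem ofPoly_monomial (n : ℕ) (a : F) :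
    ofPoly (monomial n a) = HahnSeries.single (-(n : ℤ)) a := by
  simp [ofPoly, HahnSeries.C_apply, HahnSeries.single_pow]

theorem coeff_ofPoly (P : F[X]) (m : ℤ) :
    (ofPoly P).coeff m = if m ≤ 0 then P.coeff (-m).toNat else 0 := by
  induction P using Polynomial.induction_on' with
  | add P Q hP hQ =>
    rw [map_add, HahnSeries.coeff_add, hP, hQ]
    split_ifs <;> simp
  | monomial n a =>
    rw [ofPoly_monomial, HahnSeries.coeff_single, coeff_monomial]
    split_ifs <;> first | rfl | omega

theorem ofPoly_injective : Function.Injective (ofPoly : F[X] →+* Series F) := by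
  rw [injective_iff_map_eq_zero]
  intro P hP
  ext i
  simpa [hP] using (coeff_ofPoly P (-(i : ℤ))).symm

theorem ofPoly_ne_zero {P : F[X]} (hP : P ≠ 0) : ofPoly P ≠ 0 :=
  (map_ne_zero_iff ofPoly ofPoly_injective).mpr hP

theorem order_ofPoly {P : F[X]} (hP : P ≠ 0) : (ofPoly P).order = -(P.natDegree : ℤ) := by
  refine le_antisymm (HahnSeries.order_le_of_coeff_ne_zero ?_)
    ((HahnSeries.le_order_iff_forall (ofPoly_ne_zero hP)).mpr fun m hm => ?_)
  · simpa [coeff_ofPoly] using hP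
  · rw [coeff_ofPoly, if_pos (by omega)]
    exact coeff_eq_zero_of_natDegree_lt (by omega)

theorem coeff_fract (x : Series F) (m : ℤ) :
    (fract x).coeff m = if 0 < m then x.coeff m else 0 := rfl

theorem fract_add (x y : Series F) : fract (x + y) = fract x + fract y := by
  ext m
  simp only [coeff_fract, HahnSeries.coeff_add]
  split_ifs <;> simp

theorem fract_ofPoly (P : F[X]) : fract (ofPoly P) = 0 := by
  ext m
  rw [coeff_fract, coeff_ofPoly]
  split_ifs <;> first | rfl | omega

theorem fract_eq_self {x : Series F} (hx : 0 < x.order) : fract x = x := by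
  ext m
  rw [coeff_fract, ite_eq_left_iff]
  exact fun hm => (HahnSeries.coeff_eq_zero_of_lt_order (by omega)).symm

theorem order_fract_pos {x : Series F} (hx : fract x ≠ 0) : 0 < (fract x).order := by
  rw [← Int.add_one_le_iff, zero_add, HahnSeries.le_order_iff_forall hx]
  intro m hm
  rw [coeff_fract, if_neg (by omega)]

theorem coeff_polyPart (x : Series F) (i : ℕ) : (polyPart x).coeff i = x.coeff (-(i : ℤ)) := by
  simp only [polyPart, finsetSum_coeff, coeff_monomial, Finset.sum_ite_eq', ite_eq_left_iff,
    Finset.mem_range, deg]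
  exact fun hi => (HahnSeries.coeff_eq_zero_of_lt_order (by omega)).symm

theorem ofPoly_polyPart_add_fract (x : Series F) : ofPoly (polyPart x) + fract x = x := by
  ext m
  rw [HahnSeries.coeff_add, coeff_ofPoly, coeff_fract, coeff_polyPart]
  rcases le_or_gt m 0 with hm | hm
  · simp [hm, hm.not_gt]
  · simp [hm, hm.not_ge]

theorem natDegree_polyPart {x : Series F} (hx : x ≠ 0) (h : x.order ≤ 0) :
    ((polyPart x).natDegree : ℤ) = -x.order := by
  suffices (polyPart x).natDegree = (-x.order).toNat by omega
  apply natDegree_eq_of_le_of_coeff_ne_zero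
  · rw [natDegree_le_iff_coeff_eq_zero]
    intro i hi
    rw [coeff_polyPart]
    exact HahnSeries.coeff_eq_zero_of_lt_order (by omega)
  · rw [coeff_polyPart, Int.toNat_of_nonneg (by omega), neg_neg]
    exact HahnSeries.coeff_order_eq_zero.not.mpr hx

theorem order_inv {x : Series F} (hx : x ≠ 0) : x⁻¹.order = -x.order := by
  have h := HahnSeries.order_mul hx (inv_ne_zero hx)
  rw [mul_inv_cancel₀ hx, HahnSeries.order_one] at h
  omega

theorem IsIrrational.fract_ne_zero {x : Series F} (hx : IsIrrational x) : fract x ≠ 0 := by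
  intro h
  apply hx (polyPart x) 1 one_ne_zero
  rw [map_one, div_one]
  conv_lhs => rw [← ofPoly_polyPart_add_fract x, h, add_zero]

theorem IsIrrational.inv_fract {x : Series F} (hx : IsIrrational x) :
    IsIrrational (fract x)⁻¹ := by
  intro P Q _ h
  have hfract : fract x = ofPoly Q / ofPoly P := by rw [← inv_inv (fract x), h, inv_div]
  have hP : P ≠ 0 := by
    rintro rfl
    exact hx.fract_ne_zero (by rw [hfract, map_zero, div_zero])
  apply hx (polyPart x * P + Q) P hP
  conv_lhs => rw [← ofPoly_polyPart_add_fract x, hfract]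
  rw [map_add, map_mul, add_div, mul_div_cancel_right₀ _ (ofPoly_ne_zero hP)]

end Series

section ContinuedFraction

variable {F : Type*} [Field F] {f : Series F}

theorem isIrrational_completeQuot (hf : IsIrrational f) : ∀ k, IsIrrational (completeQuot f k)
  | 0 => hf
  | k + 1 => (isIrrational_completeQuot hf k).inv_fract

theorem fract_completeQuot_ne_zero (hf : IsIrrational f) (k : ℕ) :
    fract (completeQuot f k) ≠ 0 :=
  (isIrrational_completeQuot hf k).fract_ne_zero

theorem ofPoly_partialQuot (f : Series F) (k : ℕ) :
    ofPoly (partialQuot f k) = completeQuot f k - fract (completeQuot f k) :=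
  eq_sub_of_add_eq (ofPoly_polyPart_add_fract _)

theorem order_fract_completeQuot (hf : IsIrrational f) (k : ℕ) :
    (fract (completeQuot f k)).order = (partialQuot f (k + 1)).natDegree := by
  have h0 := fract_completeQuot_ne_zero hf k
  have hne : completeQuot f (k + 1) ≠ 0 := inv_ne_zero h0
  have horder : (completeQuot f (k + 1)).order = -(fract (completeQuot f k)).order := order_inv h0
  have hpos := order_fract_pos h0
  rw [partialQuot, natDegree_polyPart hne (by omega), horder, neg_neg]

theorem natDegree_partialQuot_succ_pos (hf : IsIrrational f) (k : ℕ) :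
    0 < (partialQuot f (k + 1)).natDegree := by
  have hpos := order_fract_pos (fract_completeQuot_ne_zero hf k)
  rw [order_fract_completeQuot hf] at hpos
  omega

theorem convDeg_zero : convDeg f 0 = 0 := natDegree_one

theorem convDen_ne_zero_and_convDeg_succ (hf : IsIrrational f) (k : ℕ) :
    convDen f k ≠ 0 ∧ convDeg f (k + 1) = (partialQuot f (k + 1)).natDegree + convDeg f k := by
  induction k with
  | zero => exact ⟨one_ne_zero, by rw [convDeg_zero]; rfl⟩
  | succ k ih =>
    have hlt : convDeg f k < convDeg f (k + 1) := by
      have := natDegree_partialQuot_succ_pos hf k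
      omega
    have hden : convDen f (k + 1) ≠ 0 :=
      ne_zero_of_natDegree_gt (n := convDeg f k) hlt
    have hquot : partialQuot f (k + 2) ≠ 0 :=
      ne_zero_of_natDegree_gt (natDegree_partialQuot_succ_pos hf (k + 1))
    have hmul : (partialQuot f (k + 2) * convDen f (k + 1)).natDegree =
        (partialQuot f (k + 2)).natDegree + convDeg f (k + 1) := natDegree_mul hquot hden
    refine ⟨hden, ?_⟩
    rw [convDeg, convDen, natDegree_add_eq_left_of_natDegree_lt, hmul]
    rw [hmul]
    exact hlt.trans_le (Nat.le_add_left _ _)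

theorem convDen_ne_zero (hf : IsIrrational f) (k : ℕ) : convDen f k ≠ 0 :=
  (convDen_ne_zero_and_convDeg_succ hf k).1

theorem convDeg_succ (hf : IsIrrational f) (k : ℕ) :
    convDeg f (k + 1) = (partialQuot f (k + 1)).natDegree + convDeg f k :=
  (convDen_ne_zero_and_convDeg_succ hf k).2

theorem strictMono_convDeg (hf : IsIrrational f) : StrictMono (convDeg f) :=
  strictMono_nat_of_lt_succ fun k => by
    have := natDegree_partialQuot_succ_pos hf k
    rw [convDeg_succ hf]
    omega

/-- The remainder `Qₖ f - Pₖ` of the `k`-th principal convergent of `f`. -/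
def convRem (f : Series F) (k : ℕ) : Series F := ofPoly (convDen f k) * f - ofPoly (convNum f k)

theorem convRem_zero : convRem f 0 = fract f := by
  rw [convRem, convDen, convNum, ofPoly_partialQuot, map_one, one_mul]
  exact sub_sub_cancel _ _

theorem convRem_succ (hf : IsIrrational f) (k : ℕ) :
    convRem f (k + 1) = -(fract (completeQuot f (k + 1)) * convRem f k) := by
  have hinv (k : ℕ) : completeQuot f (k + 1) * fract (completeQuot f k) = 1 :=
    inv_mul_cancel₀ (fract_completeQuot_ne_zero hf k)
  induction k with
  | zero =>
    have hrec : convRem f 1 = ofPoly (partialQuot f 1) * convRem f 0 - 1 := by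
      simp only [convRem, convDen, convNum, map_add, map_mul, map_one]
      ring
    have hzero : convRem f 0 = fract (completeQuot f 0) := convRem_zero
    rw [hrec, ofPoly_partialQuot, hzero]
    linear_combination hinv 0
  | succ k ih =>
    have hrec : convRem f (k + 2) =
        ofPoly (partialQuot f (k + 2)) * convRem f (k + 1) + convRem f k := by
      simp only [convRem, convDen, convNum, map_add, map_mul]
      ring
    rw [hrec, ofPoly_partialQuot]
    linear_combination completeQuot f (k + 2) * ih - convRem f k * hinv (k + 1)

theorem convRem_ne_zero (hf : IsIrrational f) (k : ℕ) : convRem f k ≠ 0 := by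
  induction k with
  | zero => exact convRem_zero.trans_ne hf.fract_ne_zero
  | succ k ih =>
    rw [convRem_succ hf]
    exact neg_ne_zero.mpr (mul_ne_zero (fract_completeQuot_ne_zero hf _) ih)

theorem order_convRem (hf : IsIrrational f) (k : ℕ) :
    (convRem f k).order = convDeg f (k + 1) := by
  induction k with
  | zero =>
    rw [convRem_zero, convDeg_succ hf, convDeg_zero, add_zero]
    exact order_fract_completeQuot hf 0
  | succ k ih =>
    rw [convRem_succ hf, HahnSeries.order_neg,
      HahnSeries.order_mul (fract_completeQuot_ne_zero hf _) (convRem_ne_zero hf k), ih,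
      order_fract_completeQuot hf, convDeg_succ hf (k + 1), Nat.cast_add]

theorem order_ofPoly_mul_convRem (hf : IsIrrational f) (k : ℕ) {A : F[X]} (hA : A ≠ 0) :
    (ofPoly A * convRem f k).order = convDeg f (k + 1) - A.natDegree := by
  rw [HahnSeries.order_mul (ofPoly_ne_zero hA) (convRem_ne_zero hf k), order_ofPoly hA,
    order_convRem hf, neg_add_eq_sub]

theorem fract_ofPoly_mul_convDen_mul (hf : IsIrrational f) {k : ℕ} {A : F[X]} (hA : A ≠ 0)
    (hdeg : A.natDegree < convDeg f (k + 1)) :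
    fract (ofPoly (A * convDen f k) * f) = ofPoly A * convRem f k := by
  have hsplit : ofPoly (A * convDen f k) * f =
      ofPoly (A * convNum f k) + ofPoly A * convRem f k := by
    rw [convRem, map_mul, map_mul]
    ring
  have horder := order_ofPoly_mul_convRem hf k hA
  rw [hsplit, fract_add, fract_ofPoly, zero_add, fract_eq_self (by omega)]

end ContinuedFraction

section Coordinates

variable {F : Type*} [Field F] [Finite F]

variable (F) in
/-- The first `l` coefficients of an element of `𝕃`; those of `X⁻¹, …, X⁻ˡ`. -/
def coords (l : ℕ) : UnitBall F →+ (Fin l → F) where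
  toFun g i := g.val.coeff ((i : ℕ) + 1 : ℤ)
  map_zero' := rfl
  map_add' _ _ := rfl

theorem coords_apply {l : ℕ} (g : UnitBall F) (i : Fin l) :
    coords F l g i = g.val.coeff ((i : ℕ) + 1 : ℤ) := rfl

theorem UnitBall.coeff_of_nonpos (g : UnitBall F) {m : ℤ} (hm : m ≤ 0) : g.val.coeff m = 0 :=
  absVal_lt_one_iff.mp g.2 m (by omega)

theorem coords_eq_iff {l : ℕ} {g h : UnitBall F} :
    coords F l g = coords F l h ↔ ∀ m : ℤ, m ≤ l → g.val.coeff m = h.val.coeff m := by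
  refine ⟨fun heq m hm => ?_, fun heq => funext fun i => heq _ (by omega)⟩
  rcases le_or_gt m 0 with hm0 | hm0
  · rw [g.coeff_of_nonpos hm0, h.coeff_of_nonpos hm0]
  · obtain ⟨i, rfl⟩ : ∃ i : ℕ, m = i + 1 := ⟨(m - 1).toNat, by omega⟩
    exact congrFun heq ⟨i, by omega⟩

theorem coords_eq_of_le {l l' : ℕ} (hl : l ≤ l') {g h : UnitBall F}
    (heq : coords F l' g = coords F l' h) : coords F l g = coords F l h := by
  rw [coords_eq_iff] at heq ⊢
  exact fun m hm => heq m (by omega)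

theorem coords_eq_zero_iff {l : ℕ} {g : UnitBall F} (hg : g.val ≠ 0) :
    coords F l g = 0 ↔ (l : ℤ) < g.val.order := by
  rw [← map_zero (coords F l), coords_eq_iff, ← Int.add_one_le_iff,
    HahnSeries.le_order_iff_forall hg]
  simp only [Int.lt_add_one_iff]
  rfl

theorem absVal_sub_lt_iff {l : ℕ} {g h : UnitBall F} :
    absVal (g.val - h.val) < 1 / (Nat.card F : ℝ) ^ l ↔ coords F l g = coords F l h := by
  have hq := one_lt_q F
  have hq0 : (0 : ℝ) < Nat.card F := one_pos.trans hq
  have hle : absVal (g.val - h.val) < 1 / (Nat.card F : ℝ) ^ l ↔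
      absVal (g.val - h.val) ≤ (Nat.card F : ℝ) ^ (-((l : ℤ) + 1)) := by
    rw [one_div, ← zpow_natCast, ← zpow_neg]
    by_cases hgh : g.val - h.val = 0
    · rw [hgh, absVal_zero]
      exact iff_of_true (zpow_pos hq0 _) (zpow_pos hq0 _).le
    · rw [absVal, if_neg hgh, zpow_lt_zpow_iff_right₀ hq, zpow_le_zpow_iff_right₀ hq]
      omega
  rw [hle, absVal_le_zpow_iff, coords_eq_iff]
  simp only [Int.lt_add_one_iff, HahnSeries.coeff_sub, sub_eq_zero]

theorem coords_surjective (l : ℕ) : Function.Surjective (coords F l) := fun v => by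
  refine ⟨UnitBall.mk fun i => if h : i < l then v ⟨i, h⟩ else 0, funext fun i => ?_⟩
  rw [coords_apply, UnitBall.mk_coeff, if_pos (by omega)]
  simp

theorem isLocallyConstant_coords (l : ℕ) : IsLocallyConstant (coords F l) :=
  (IsLocallyConstant.iff_eventually_eq _).mpr fun g => by
    have hq0 : (0 : ℝ) < Nat.card F := one_pos.trans (one_lt_q F)
    filter_upwards [Metric.ball_mem_nhds g (one_div_pos.mpr (pow_pos hq0 l))] with h hh
    rwa [← absVal_sub_lt_iff, ← dist_eq]

theorem measurableSet_coords_preimage (l : ℕ) (S : Set (Fin l → F)) :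
    MeasurableSet (coords F l ⁻¹' S) :=
  (isLocallyConstant_coords l S).measurableSet

theorem haar_coords_preimage (l : ℕ) (S : Set (Fin l → F)) :
    haar F (coords F l ⁻¹' S) = S.ncard / (Nat.card F : ENNReal) ^ l := by
  have h := measure_inter_preimage_of_invariant (μ := haar F) (φ := coords F l) (E := Set.univ)
    (fun v => measurableSet_coords_preimage l {v})
    (fun v => (coords_surjective l v).imp fun _ ht => ⟨ht, Set.preimage_univ⟩) S
  simpa [Nat.card_fun] using h

end Coordinates

section Multiples

variable {F : Type*} [Field F] [Finite F]

/-- The homomorphism `Q ↦ {Q f}`. -/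
def fractMul (f : UnitBall F) : F[X] →+ UnitBall F where
  toFun Q := ⟨fract (ofPoly Q * f.val), absVal_lt_one_iff.mpr fun _ hn => if_neg (by omega)⟩
  map_zero' := Subtype.ext <| by
    change fract (ofPoly 0 * f.val) = 0
    rw [map_zero, zero_mul, ← map_zero (ofPoly (F := F)), fract_ofPoly, map_zero]
  map_add' P Q := Subtype.ext <| by
    change fract (ofPoly (P + Q) * f.val) = fract (ofPoly P * f.val) + fract (ofPoly Q * f.val)
    rw [map_add, add_mul, fract_add]

theorem val_fractMul (f : UnitBall F) (Q : F[X]) :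
    (fractMul f Q).val = fract (ofPoly Q * f.val) := rfl

/-- The points at distance less than `q ^ (-l)` from `{Q f}` for some `Q ∈ T`; the distance is
expressed through the first `l` coefficients, see `absVal_sub_lt_iff`. -/
def fractMulNhd (f : UnitBall F) (T : Set F[X]) (l : ℕ) : Set (UnitBall F) :=
  {g | ∃ Q ∈ T, coords F l (fractMul f Q) = coords F l g}

/-- The points at distance less than `q ^ (-L n)` from `{Q f}` for some `Q` of degree `n`. -/
def approxSet (f : UnitBall F) (L : ℕ → ℕ) (n : ℕ) : Set (UnitBall F) :=
  fractMulNhd f {Q | Q.degree = n} (L n)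

omit [Finite F] in
theorem natCard_degreeLT (n : ℕ) : Nat.card (degreeLT F n) = Nat.card F ^ n := by
  rw [Nat.card_congr (degreeLTEquiv F n).toEquiv, Nat.card_fun, Nat.card_fin]

theorem finite_degreeLT (n : ℕ) : (degreeLT F n : Set F[X]).Finite :=
  Finite.of_equiv _ (degreeLTEquiv F n).toEquiv.symm

variable (F) in
theorem card_zpow_sub (m n : ℕ) : (Nat.card F : ENNReal) ^ ((m : ℤ) - n) =
    (Nat.card F : ENNReal) ^ m / (Nat.card F : ENNReal) ^ n := by
  rw [ENNReal.zpow_sub (by exact_mod_cast Nat.card_pos.ne') (ENNReal.natCast_ne_top _),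
    zpow_natCast, zpow_natCast, div_eq_mul_inv]

variable {f : UnitBall F}

theorem fractMulNhd_eq_preimage (f : UnitBall F) (T : Set F[X]) (l : ℕ) :
    fractMulNhd f T l = coords F l ⁻¹' ((fun Q => coords F l (fractMul f Q)) '' T) := rfl

theorem measurableSet_fractMulNhd (T : Set F[X]) (l : ℕ) : MeasurableSet (fractMulNhd f T l) := by
  rw [fractMulNhd_eq_preimage]
  exact measurableSet_coords_preimage l _

theorem haar_fractMulNhd (T : Set F[X]) (l : ℕ) :
    haar F (fractMulNhd f T l) =
      ((fun Q => coords F l (fractMul f Q)) '' T).ncard / (Nat.card F : ENNReal) ^ l := by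
  rw [fractMulNhd_eq_preimage, haar_coords_preimage]

theorem haar_fractMulNhd_degreeLT_le (n l : ℕ) :
    haar F (fractMulNhd f (degreeLT F n) l) ≤ (Nat.card F : ENNReal) ^ ((n : ℤ) - l) := by
  rw [haar_fractMulNhd, card_zpow_sub, ← Nat.cast_pow (Nat.card F) n]
  gcongr
  exact (Set.ncard_image_le (finite_degreeLT n)).trans_eq (natCard_degreeLT n)

theorem approxSet_anti {l L : ℕ → ℕ} (h : l ≤ L) (n : ℕ) : approxSet f L n ⊆ approxSet f l n :=
  fun _ ⟨Q, hQ, heq⟩ => ⟨Q, hQ, coords_eq_of_le (h n) heq⟩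

theorem infinite_setOf_absVal_lt_iff (l : ℕ → ℕ) (g : UnitBall F) :
    {Q : F[X] | ∃ n : ℕ, Q.degree = n ∧
      absVal (fract (ofPoly Q * f.val) - g.val) < 1 / (Nat.card F : ℝ) ^ l n}.Infinite ↔
    {n | g ∈ approxSet f l n}.Infinite := by
  have happrox (Q : F[X]) (n : ℕ) : absVal (fract (ofPoly Q * f.val) - g.val) <
      1 / (Nat.card F : ℝ) ^ l n ↔ coords F (l n) (fractMul f Q) = coords F (l n) g := by
    rw [← val_fractMul, absVal_sub_lt_iff]
  simp only [happrox, ← not_iff_not (a := Set.Infinite _), Set.not_infinite]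
  constructor <;> intro hfin
  · refine (hfin.image natDegree).subset ?_
    rintro n ⟨Q, hQ, heq⟩
    exact ⟨Q, ⟨n, hQ, heq⟩, natDegree_eq_of_degree_eq_some hQ⟩
  · refine (hfin.biUnion fun n _ => finite_degreeLT (n + 1)).subset ?_
    rintro Q ⟨n, hQ, heq⟩
    refine Set.mem_biUnion (x := n) ⟨Q, hQ, heq⟩ (mem_degreeLT.mpr ?_)
    rw [hQ]
    exact_mod_cast n.lt_succ_self

end Multiples

section Separation

variable {F : Type*} [Field F] [Finite F] {f : UnitBall F}

theorem coords_fractMul_mul_convDen_eq_zero_iff (hf : IsIrrational f.val) {k l : ℕ} {A : F[X]}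
    (hA : A ≠ 0) (hdeg : A.natDegree < convDeg f.val (k + 1)) :
    coords F l (fractMul f (A * convDen f.val k)) = 0 ↔
      l + A.natDegree < convDeg f.val (k + 1) := by
  have hval : (fractMul f (A * convDen f.val k)).val = ofPoly A * convRem f.val k :=
    fract_ofPoly_mul_convDen_mul hf hA hdeg
  have hne : ofPoly A * convRem f.val k ≠ 0 :=
    mul_ne_zero (ofPoly_ne_zero hA) (convRem_ne_zero hf k)
  rw [coords_eq_zero_iff (hval.trans_ne hne), hval, order_ofPoly_mul_convRem hf k hA]
  omega

theorem coords_fractMul_mul_convDen_eq_zero (hf : IsIrrational f.val) {k l : ℕ} {A : F[X]}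
    (hlt : l + A.natDegree < convDeg f.val (k + 1)) :
    coords F l (fractMul f (A * convDen f.val k)) = 0 := by
  obtain rfl | hA := eq_or_ne A 0
  · rw [zero_mul, map_zero, map_zero]
  · exact (coords_fractMul_mul_convDen_eq_zero_iff hf hA (by omega)).mpr hlt

theorem exists_eq_mul_convDen_add (hf : IsIrrational f.val) (k : ℕ) (Q : F[X]) :
    ∃ A, ∃ R ∈ degreeLT F (convDeg f.val k),
      A.natDegree = Q.natDegree - convDeg f.val k ∧ Q = A * convDen f.val k + R := by
  have hden := convDen_ne_zero hf k
  refine ⟨Q / convDen f.val k, Q % convDen f.val k, mem_degreeLT.mpr ?_, ?_, ?_⟩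
  · rw [convDeg, ← degree_eq_natDegree hden]
    exact EuclideanDomain.mod_lt _ hden
  · rw [div_def, natDegree_C_mul (inv_ne_zero (leadingCoeff_ne_zero.mpr hden)),
      natDegree_divByMonic _ (monic_mul_leadingCoeff_inv hden),
      natDegree_mul_leadingCoeff_inv _ hden, convDeg]
  · rw [mul_comm, EuclideanDomain.div_add_mod]

theorem exists_coords_fractMul_eq_of_natDegree_lt (hf : IsIrrational f.val) {k l : ℕ} {Q : F[X]}
    (hk : convDeg f.val k ≤ Q.natDegree)
    (hl : l + Q.natDegree < convDeg f.val k + convDeg f.val (k + 1)) :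
    ∃ R ∈ degreeLT F (convDeg f.val k),
      coords F l (fractMul f Q) = coords F l (fractMul f R) := by
  obtain ⟨A, R, hR, hA, hQ⟩ := exists_eq_mul_convDen_add hf k Q
  refine ⟨R, hR, ?_⟩
  rw [hQ, map_add, map_add, coords_fractMul_mul_convDen_eq_zero hf (by omega), zero_add]

theorem eq_zero_of_coords_fractMul_eq_zero (hf : IsIrrational f.val) {k : ℕ} {Q : F[X]}
    (hQ : Q ∈ degreeLT F (convDeg f.val k))
    (hcoords : coords F (convDeg f.val k) (fractMul f Q) = 0) : Q = 0 := by
  induction k generalizing Q with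
  | zero => simpa [mem_degreeLT, convDeg_zero] using hQ
  | succ k ih =>
    by_contra hne
    have hmono := strictMono_convDeg hf k.lt_add_one
    have hdegQ := (natDegree_lt_iff_degree_lt hne).mpr (mem_degreeLT.mp hQ)
    obtain ⟨A, R, hR, hdegA, rfl⟩ := exists_eq_mul_convDen_add hf k Q
    have hdeg : A.natDegree + convDeg f.val k < convDeg f.val (k + 1) := by omega
    have hR0 : R = 0 := by
      refine ih hR ?_
      have hle := coords_eq_of_le hmono.le (hcoords.trans (map_zero _).symm)
      rwa [map_add, map_add, coords_fractMul_mul_convDen_eq_zero hf (by omega), zero_add,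
        map_zero] at hle
    have hA : A ≠ 0 := by
      rintro rfl
      simp [hR0] at hne
    rw [hR0, add_zero, coords_fractMul_mul_convDen_eq_zero_iff hf hA (by omega)] at hcoords
    omega

theorem injOn_coords_fractMul (hf : IsIrrational f.val) {k l : ℕ} (hl : convDeg f.val k ≤ l) :
    Set.InjOn (fun Q => coords F l (fractMul f Q)) (degreeLT F (convDeg f.val k)) := by
  intro P hP Q hQ heq
  refine sub_eq_zero.mp (eq_zero_of_coords_fractMul_eq_zero hf (Submodule.sub_mem _ hP hQ) ?_)
  rw [map_sub, map_sub, sub_eq_zero]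
  exact coords_eq_of_le hl heq

theorem exists_mem_degreeLT_coords_fractMul_eq (hf : IsIrrational f.val) {k l : ℕ}
    (hl : l ≤ convDeg f.val k) (v : Fin l → F) :
    ∃ R ∈ degreeLT F (convDeg f.val k), coords F l (fractMul f R) = v := by
  obtain ⟨g, rfl⟩ := coords_surjective l v
  have hcard : Nat.card (Fin (convDeg f.val k) → F) ≤ Nat.card (degreeLT F (convDeg f.val k)) := by
    rw [Nat.card_fun, Nat.card_fin, natCard_degreeLT]
  have hbij := (injOn_coords_fractMul hf le_rfl).injective.bijective_of_nat_card_le hcard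
  obtain ⟨R, hR⟩ := hbij.surjective (coords F (convDeg f.val k) g)
  exact ⟨R, R.2, coords_eq_of_le hl hR⟩

end Separation

section Divergence

variable {F : Type*} [Field F] [Finite F] {f : UnitBall F} {L : ℕ → ℕ}

theorem disjoint_approxSet (hf : IsIrrational f.val) {k m n : ℕ} (hmn : m ≠ n)
    (hm : m < convDeg f.val k) (hn : n < convDeg f.val k) (hLm : convDeg f.val k ≤ L m)
    (hLn : convDeg f.val k ≤ L n) : Disjoint (approxSet f L m) (approxSet f L n) := by
  rw [Set.disjoint_left]
  rintro g ⟨P, hP, hPg⟩ ⟨Q, hQ, hQg⟩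
  have hmem {d : ℕ} (hd : d < convDeg f.val k) {R : F[X]} (hR : R.degree = d) :
      R ∈ degreeLT F (convDeg f.val k) := by
    rw [mem_degreeLT, hR]
    exact_mod_cast hd
  have hPQ : P = Q := injOn_coords_fractMul hf le_rfl (hmem hm hP) (hmem hn hQ)
    ((coords_eq_of_le hLm hPg).trans (coords_eq_of_le hLn hQg).symm)
  subst hPQ
  exact hmn (by exact_mod_cast hP.symm.trans hQ)

theorem card_zpow_le_haar_approxSet (hf : IsIrrational f.val) {k n : ℕ}
    (hn : n < convDeg f.val k) (hL : convDeg f.val k ≤ L n) :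
    (Nat.card F : ENNReal) ^ ((n : ℤ) - L n) ≤ haar F (approxSet f L n) := by
  set S : Set F[X] := (X ^ n + ·) '' degreeLT F n
  have hdeg : S ⊆ {Q | Q.degree = n} := by
    rintro _ ⟨R, hR, rfl⟩
    have hRX : R.degree < (X ^ n : F[X]).degree := by
      rw [degree_X_pow]
      exact mem_degreeLT.mp hR
    exact (degree_add_eq_left_of_degree_lt hRX).trans (degree_X_pow n)
  have hinj : Set.InjOn (fun Q => coords F (L n) (fractMul f Q)) S :=
    (injOn_coords_fractMul hf hL).mono fun Q hQ => by
      rw [SetLike.mem_coe, mem_degreeLT, show Q.degree = n from hdeg hQ]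
      exact_mod_cast hn
  have hcard : S.ncard = Nat.card F ^ n := by
    rw [Set.ncard_image_of_injective _ (add_right_injective _), ← natCard_degreeLT]
    rfl
  rw [approxSet, haar_fractMulNhd, card_zpow_sub, ← Nat.cast_pow, ← hcard,
    ← hinj.ncard_image]
  gcongr
  exact Set.toFinite _

theorem preimage_add_fractMul_approxSet {n : ℕ} {R : F[X]} (hR : R.degree < n) :
    (fractMul f R + ·) ⁻¹' approxSet f L n = approxSet f L n := by
  ext g
  constructor
  · rintro ⟨Q, hQ, hQg⟩
    refine ⟨Q - R, (degree_sub_eq_left_of_degree_lt (hR.trans_eq hQ.symm)).trans hQ, ?_⟩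
    rw [map_sub, map_sub, hQg, map_add, add_sub_cancel_left]
  · rintro ⟨Q, hQ, hQg⟩
    refine ⟨R + Q, (degree_add_eq_right_of_degree_lt (hR.trans_eq hQ.symm)).trans hQ, ?_⟩
    rw [map_add, map_add, map_add, hQg]

theorem haar_approxSet_inter_preimage (hf : IsIrrational f.val) {k l n : ℕ}
    (hl : l ≤ convDeg f.val k) (hn : convDeg f.val k ≤ n) (S : Set (Fin l → F)) :
    haar F (approxSet f L n ∩ coords F l ⁻¹' S) =
      haar F (approxSet f L n) * haar F (coords F l ⁻¹' S) := by
  rw [measure_inter_preimage_of_invariant (fun v => measurableSet_coords_preimage l {v}),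
    haar_coords_preimage, Nat.card_fun, Nat.card_fin, Nat.cast_pow]
  intro v
  obtain ⟨R, hR, hRv⟩ := exists_mem_degreeLT_coords_fractMul_eq hf hl v
  refine ⟨fractMul f R, hRv, preimage_add_fractMul_approxSet ?_⟩
  exact (mem_degreeLT.mp hR).trans_le (by exact_mod_cast hn)

theorem measureReal_approxSet_inter_le (hf : IsIrrational f.val)
    (hL : ∀ n, convDeg f.val (blockIndex (convDeg f.val) n + 1) ≤ L n) {m n : ℕ} (hmn : m < n)
    (hk : blockIndex (convDeg f.val) n ≠ blockIndex (convDeg f.val) (L m)) :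
    (haar F).real (approxSet f L m ∩ approxSet f L n) ≤
      (haar F).real (approxSet f L m) * (haar F).real (approxSet f L n) := by
  have hmono := strictMono_convDeg hf
  have hn := lt_apply_blockIndex_add_one hmono n
  rcases hk.lt_or_gt with hlt | hgt
  · have hLm : convDeg f.val (blockIndex (convDeg f.val) n + 1) ≤ L m :=
      (hmono.monotone hlt).trans (apply_blockIndex_le convDeg_zero _)
    rw [(disjoint_approxSet hf hmn.ne (hmn.trans hn) hn hLm (hL n)).inter_eq,
      measureReal_empty]
    positivity
  · have hLm : L m ≤ convDeg f.val (blockIndex (convDeg f.val) n) :=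
      (lt_apply_blockIndex_add_one hmono _).le.trans (hmono.monotone hgt)
    have hindep := haar_approxSet_inter_preimage (L := L) hf hLm
      (apply_blockIndex_le convDeg_zero n)
      ((fun Q => coords F (L m) (fractMul f Q)) '' {Q | Q.degree = m})
    rw [← fractMulNhd_eq_preimage, ← approxSet] at hindep
    rw [Set.inter_comm, mul_comm, measureReal_def, hindep, ENNReal.toReal_mul]
    rfl

theorem sum_measureReal_approxSet_inter_le (hf : IsIrrational f.val)
    (hL : ∀ n, convDeg f.val (blockIndex (convDeg f.val) n + 1) ≤ L n) {s : Finset ℕ} {k : ℕ}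
    (hs : ∀ n ∈ s, blockIndex (convDeg f.val) n = k) (E : Set (UnitBall F)) :
    ∑ n ∈ s, (haar F).real (E ∩ approxSet f L n) ≤ (haar F).real E := by
  have hdisj : Set.PairwiseDisjoint (s : Set ℕ) (approxSet f L) := fun m hm n hn hmn => by
    have hlt := lt_apply_blockIndex_add_one (strictMono_convDeg hf)
    exact disjoint_approxSet hf hmn (hs m hm ▸ hlt m) (hs n hn ▸ hlt n) (hs m hm ▸ hL m)
      (hs n hn ▸ hL n)
  have hmeas (n : ℕ) : MeasurableSet (approxSet f L n) := measurableSet_fractMulNhd _ _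
  have hsum := sum_measureReal_le_measureReal_univ (μ := (haar F).restrict E)
    (fun n _ => hmeas n) hdisj
  simpa only [measureReal_restrict_apply (hmeas _), measureReal_restrict_apply_univ,
    Set.inter_comm _ E] using hsum

theorem sum_Ioo_covariance_approxSet_le (hf : IsIrrational f.val)
    (hL : ∀ n, convDeg f.val (blockIndex (convDeg f.val) n + 1) ≤ L n) (m N : ℕ) :
    ∑ n ∈ Finset.Ioo m N, ((haar F).real (approxSet f L m ∩ approxSet f L n) -
      (haar F).real (approxSet f L m) * (haar F).real (approxSet f L n)) ≤
      (haar F).real (approxSet f L m) := by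
  set k := blockIndex (convDeg f.val) (L m)
  calc _ ≤ ∑ n ∈ Finset.Ioo m N, if blockIndex (convDeg f.val) n = k then
        (haar F).real (approxSet f L m ∩ approxSet f L n) else 0 := by
        refine Finset.sum_le_sum fun n hn => ?_
        split_ifs with hk
        · exact sub_le_self _ (by positivity)
        · exact sub_nonpos.mpr
            (measureReal_approxSet_inter_le hf hL (Finset.mem_Ioo.mp hn).1 hk)
    _ = ∑ n ∈ Finset.Ioo m N with blockIndex (convDeg f.val) n = k,
        (haar F).real (approxSet f L m ∩ approxSet f L n) := (Finset.sum_filter _ _).symm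
    _ ≤ (haar F).real (approxSet f L m) :=
        sum_measureReal_approxSet_inter_le hf hL (fun n hn => (Finset.mem_filter.mp hn).2) _

theorem ae_infinite_mem_approxSet (hf : IsIrrational f.val)
    (hL : ∀ n, convDeg f.val (blockIndex (convDeg f.val) n + 1) ≤ L n)
    (hdiv : ∑' n : ℕ, (Nat.card F : ENNReal) ^ ((n : ℤ) - L n) = ⊤) :
    ∀ᵐ g ∂haar F, {n | g ∈ approxSet f L n}.Infinite := by
  refine ae_infinite_of_sum_Ioo_covariance_le (C := 1)
    (fun n => measurableSet_fractMulNhd _ _) (fun m N => ?_) ?_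
  · rw [one_mul]
    exact sum_Ioo_covariance_approxSet_le hf hL m N
  · refine top_le_iff.mp (hdiv.symm.trans_le (ENNReal.tsum_le_tsum fun n => ?_))
    exact card_zpow_le_haar_approxSet hf (lt_apply_blockIndex_add_one (strictMono_convDeg hf) n)
      (hL n)

end Divergence

section Convergence

variable {F : Type*} [Field F] [Finite F] {f : UnitBall F} {l : ℕ → ℕ}

/-- For `n` in the block `[nₖ, nₖ₊₁)`, a union of balls around points `{R f}`: around all those with
`deg R ≤ n` and of radius `q ^ (-l n)` if `nₖ₊₁ ≤ l n`, and otherwise around those with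
`deg R < nₖ` and of the radius for which the bound on the measure is `q ^ (n + 1 - nₖ₊₁)`. -/
def cover (f : UnitBall F) (l : ℕ → ℕ) (n : ℕ) : Set (UnitBall F) :=
  let k := blockIndex (convDeg f.val) n
  if convDeg f.val (k + 1) ≤ l n then fractMulNhd f (degreeLT F (n + 1)) (l n)
  else fractMulNhd f (degreeLT F (convDeg f.val k))
    (convDeg f.val k + convDeg f.val (k + 1) - (n + 1))

theorem haar_cover_le (hf : IsIrrational f.val) (l : ℕ → ℕ) (n : ℕ) :
    haar F (cover f l n) ≤ (Nat.card F : ENNReal) ^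
      ((n + 1 : ℤ) - max (convDeg f.val (blockIndex (convDeg f.val) n + 1) : ℤ) (l n)) := by
  have hn := lt_apply_blockIndex_add_one (strictMono_convDeg hf) n
  rw [cover]
  split_ifs with h
  all_goals
    refine (haar_fractMulNhd_degreeLT_le _ _).trans_eq ?_
    congr 1
    omega

theorem fractMulNhd_degreeLT_subset_cover (hf : IsIrrational f.val) (hl : Monotone l) {k n : ℕ}
    (hk : 0 < k) (hn : convDeg f.val k ≤ n) :
    fractMulNhd f (degreeLT F (convDeg f.val k)) (l n) ⊆ cover f l (convDeg f.val k - 1) := by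
  obtain ⟨k, rfl⟩ := Nat.exists_eq_add_one.mpr hk
  have hlt := strictMono_convDeg hf k.lt_add_one
  rintro g ⟨R, hR, hRg⟩
  rw [cover, blockIndex_eq (strictMono_convDeg hf) (Nat.le_sub_one_of_lt hlt) (by omega),
    Nat.sub_add_cancel (by omega), Nat.add_sub_cancel]
  split_ifs
  · exact ⟨R, hR, coords_eq_of_le (hl (by omega)) hRg⟩
  · exact exists_mem_degreeLT_coords_fractMul_eq hf le_rfl _

theorem approxSet_subset_cover (hf : IsIrrational f.val) (hl : Monotone l) {n : ℕ}
    (hk : 0 < blockIndex (convDeg f.val) n) :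
    approxSet f l n ⊆
      cover f l n ∪ cover f l (convDeg f.val (blockIndex (convDeg f.val) n) - 1) := by
  have hkn := apply_blockIndex_le (u := convDeg f.val) convDeg_zero n
  have hnk := lt_apply_blockIndex_add_one (strictMono_convDeg hf) n
  rintro g ⟨Q, hQ, hQg⟩
  have hdeg : Q.natDegree = n := natDegree_eq_of_degree_eq_some hQ
  rcases lt_or_ge (l n + n) (convDeg f.val (blockIndex (convDeg f.val) n) +
    convDeg f.val (blockIndex (convDeg f.val) n + 1)) with hlow | hhigh
  · obtain ⟨R, hR, hQR⟩ := exists_coords_fractMul_eq_of_natDegree_lt hf (l := l n)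
      (hkn.trans_eq hdeg.symm) (by omega)
    exact Or.inr (fractMulNhd_degreeLT_subset_cover hf hl hk hkn ⟨R, hR, hQR.symm.trans hQg⟩)
  · left
    rw [cover]
    split_ifs
    · refine ⟨Q, mem_degreeLT.mpr ?_, hQg⟩
      rw [show Q.degree = n from hQ]
      exact_mod_cast n.lt_succ_self
    · obtain ⟨R, hR, hQR⟩ := exists_coords_fractMul_eq_of_natDegree_lt hf
        (l := convDeg f.val (blockIndex (convDeg f.val) n) +
          convDeg f.val (blockIndex (convDeg f.val) n + 1) - (n + 1))
        (hkn.trans_eq hdeg.symm) (by omega)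
      exact ⟨R, hR, hQR.symm.trans (coords_eq_of_le (by omega) hQg)⟩

theorem tsum_haar_cover_ne_top (hf : IsIrrational f.val)
    (hconv : ∑' n : ℕ, (Nat.card F : ENNReal) ^
      ((n : ℤ) - max (convDeg f.val (blockIndex (convDeg f.val) n + 1) : ℤ) (l n)) ≠ ⊤) :
    ∑' n, haar F (cover f l n) ≠ ⊤ := by
  refine ne_top_of_le_ne_top (ENNReal.mul_ne_top (ENNReal.natCast_ne_top (Nat.card F)) hconv) ?_
  rw [← ENNReal.tsum_mul_left]
  refine ENNReal.tsum_le_tsum fun n => (haar_cover_le hf l n).trans_eq ?_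
  rw [add_comm (n : ℤ) 1, add_sub_assoc, ENNReal.zpow_add (by exact_mod_cast Nat.card_pos.ne')
    (ENNReal.natCast_ne_top _), zpow_one]

theorem ae_finite_mem_approxSet (hf : IsIrrational f.val) (hl : Monotone l)
    (hconv : ∑' n : ℕ, (Nat.card F : ENNReal) ^
      ((n : ℤ) - max (convDeg f.val (blockIndex (convDeg f.val) n + 1) : ℤ) (l n)) ≠ ⊤) :
    ∀ᵐ g ∂haar F, {n | g ∈ approxSet f l n}.Finite := by
  have hmono := strictMono_convDeg hf
  filter_upwards [ae_finite_setOfPred_mem (tsum_haar_cover_ne_top hf hconv)] with g hg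
  obtain ⟨N, hN⟩ := hg.bddAbove
  refine (Set.finite_lt_nat (convDeg f.val (N + 2))).subset fun n hn => ?_
  have hnk := lt_apply_blockIndex_add_one hmono n
  suffices blockIndex (convDeg f.val) n ≤ N + 1 from
    hnk.trans_le (hmono.monotone (Nat.succ_le_succ this))
  have hle := hmono.le_apply (x := blockIndex (convDeg f.val) n)
  have hkn := apply_blockIndex_le (u := convDeg f.val) convDeg_zero n
  rcases (blockIndex (convDeg f.val) n).eq_zero_or_pos with hk | hk
  · omega
  · rcases approxSet_subset_cover hf hl hk hn with hc | hc
    · have : n ≤ N := hN hc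
      omega
    · have : convDeg f.val (blockIndex (convDeg f.val) n) - 1 ≤ N := hN hc
      omega

end Convergence

end FormalLaurent

end

open FormalLaurent in
theorem mainTheorem5 {F : Type*} [Field F] [Finite F] (l : ℕ → ℕ) (hl : Monotone l)
    (f : UnitBall F) (hf : IsIrrational f.val) :
    ∀ᵐ g : UnitBall F ∂(haar F),
      ({Q : Polynomial F | ∃ n : ℕ, Q.degree = n ∧
          absVal (fract (ofPoly Q * f.val) - g.val) < 1 / (Nat.card F : ℝ) ^ l n}.Infinite ↔
        ∑' k : ℕ, ∑ n ∈ Finset.Ico (convDeg f.val k) (convDeg f.val (k + 1)),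
          (Nat.card F : ENNReal) ^ ((n : ℤ) - max (convDeg f.val (k + 1) : ℤ) (l n : ℤ)) = ⊤) := by
  simp_rw [infinite_setOf_absVal_lt_iff]
  rw [tsum_sum_Ico_eq_tsum_blockIndex (strictMono_convDeg hf) convDeg_zero fun k n =>
    (Nat.card F : ENNReal) ^ ((n : ℤ) - max (convDeg f.val (k + 1) : ℤ) (l n : ℤ))]
  by_cases hdiv : ∑' n : ℕ, (Nat.card F : ENNReal) ^
      ((n : ℤ) - max (convDeg f.val (blockIndex (convDeg f.val) n + 1) : ℤ) (l n)) = ⊤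
  · set L : ℕ → ℕ := fun n => max (convDeg f.val (blockIndex (convDeg f.val) n + 1)) (l n)
    filter_upwards [ae_infinite_mem_approxSet (L := L) hf (fun _ => le_max_left _ _)
      (by simpa only [L, Nat.cast_max] using hdiv)] with g hg
    exact iff_of_true (hg.mono fun n hn => approxSet_anti (fun _ => le_max_right _ _) n hn) hdiv
  · filter_upwards [ae_finite_mem_approxSet hf hl hdiv] with g hg
    exact iff_of_false (Set.not_infinite.mpr hg) hdiv
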